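/- Fix $n,m,k,d\ge 1$ and consider the generative model $X = AZ+\xi\in\mathbb R^n$, $Y=\langle w,Z\rangle$, where $A\in\mathbb R^{n\times m}$ is $\mu$-incoherent ($|(A^\top A-I)_{ij}|\le\mu$ for all $i,j$, $\mu\ge 0$), $\|w\|_\infty=1$, $Z$ is a random vector in $\mathbb R^m$, and $\xi$ is a subgaussian random vector in $\mathbb R^n$ with variance proxy $\sigma^2$ ($\sigma\ge 0$), i.e. $\mathbb E e^{t\langle u,\xi\rangle}\le e^{\sigma^2t^2/2}$ for all unit vectors $u$ and all $t\in\mathbb R$. Let $k\ge 1$, $M\ge 0$ and suppose that $|\mathrm{supp}(Z)|\le k$ and $\|Z\|_1\le M$ hold simultaneously with probability at least $1-\eta$. For $d\ge 1$, $0<t\le 1/2$, $R>0$ let $g_\beta(x)=\frac1\beta\log(1+e^{\beta x})$ with $\beta=\sqrt{\pi d/(4t)}$, let $q$ be the best uniform approximation of $g_\beta$ on $[-1,1]$ by polynomials of degree at most $d$, and let $p_{d,t,R}(x)=2R\,q\big(\tfrac{x}{2R}-t\big)$, a polynomial approximant of $\mathrm{ReLU}$ on $[-R,R]$. For $\tau>0$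 put $M_\tau=M+2\tau$. The two-layer soft-threshold network is $\langle w,\rho_\tau(A^\top X)\rangle$ with $\rho_\tau(x)=\mathrm{ReLU}(x-\tau)-\mathrm{ReLU}(-x-\tau)$ applied coordinatewise; replacing each $\mathrm{ReLU}$ by $p_{d,\tau/M_\tau,M_\tau}$ gives the estimator $\hat Y_{d,M}$. Theorem. There is an absolute constant $D>0$ such that for every $q_0>0$ there is $c>0$ such that for every $C\ge c$ there is $K>0$ with the following property. Let $T=\sigma\sqrt{(1+\mu)\log m}+\mu M$, and suppose that $\tau>0$, $cT\le\tau\le CT$, and that either $$d\ \ge\ D\Big(2+\frac M\tau\Big)\log^2\Big(\Big(2+\frac M\tau\Big)m\Big),$$ or $\tau\le\min(1,M)$ and $$d\ \ge\ D\Big(2+\frac M\tau\Big)\log^2\Big(\frac{Mm}{\tau^2}\Big).$$ Then $\hat Y_{d,M}$ is a polynomial in $X$ of degree at most $d$, and with probability at least $1-\eta-m^{-q_0}$, $$(\hat Y_{d,M}-Y)^2\ \le\ K\,k^2\big((1+\mu)\sigma^2\log m+\mu^2M^2\big).$$ -/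

import Mathlib

open MeasureTheory ProbabilityTheory Matrix Polynomial

/-- `p` is a best uniform approximation of `g` on `[-1, 1]` by polynomials of degree at most `d`:
every uniform error bound achieved by some polynomial of degree at most `d` is achieved by `p`. -/
def IsBestApprox (g : ℝ → ℝ) (d : ℕ) (p : ℝ[X]) : Prop :=
  p.natDegree ≤ d ∧
    ∀ r : ℝ[X], r.natDegree ≤ d → ∀ e : ℝ,
      (∀ x ∈ Set.Icc (-1 : ℝ) 1, |r.eval x - g x| ≤ e) →
        ∀ x ∈ Set.Icc (-1 : ℝ) 1, |p.eval x - g x| ≤ e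

/-- A continuous function has a best uniform approximation in every degree. -/
theorem exists_isBestApprox (g : ℝ → ℝ) (hg : Continuous g) (d : ℕ) :
    ∃ p : ℝ[X], IsBestApprox g d p := by
  let I : Set ℝ := Set.Icc (-1 : ℝ) 1
  let T : ℝ[X] →ₗ[ℝ] C(I, ℝ) := (Polynomial.toContinuousMapOnAlgHom I).toLinearMap
  let f : C(I, ℝ) := ⟨fun x => g x, by fun_prop⟩
  let S : Submodule ℝ C(I, ℝ) := (Polynomial.degreeLE ℝ d).map T
  have hfin : FiniteDimensional ℝ (Polynomial.degreeLE ℝ (d : WithBot ℕ)) := by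
    rw [Polynomial.degreeLE_eq_span_X_pow]
    exact FiniteDimensional.span_finset ℝ _
  have hS : FiniteDimensional ℝ S := by infer_instance
  have hP : ProperSpace S := FiniteDimensional.proper ℝ S
  have hcont : Continuous fun s : S => ‖(s : C(I, ℝ)) - f‖ := by fun_prop
  have hlim : Filter.Tendsto (fun s : S => ‖(s : C(I, ℝ)) - f‖)
      (Filter.cocompact S) Filter.atTop := by
    refine Filter.tendsto_atTop_mono (f := fun s : S => ‖s‖ + (-‖f‖)) ?_ ?_
    · intro s
      have := norm_sub_norm_le (s : C(I, ℝ)) f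
      have h2 : ‖s‖ = ‖(s : C(I, ℝ))‖ := rfl
      rw [h2]
      linarith
    · exact Filter.tendsto_atTop_add_const_right _ _ (tendsto_norm_cocompact_atTop (E := S))
  obtain ⟨s, hs⟩ := hcont.exists_forall_le hlim
  obtain ⟨p, hpd, hps⟩ := s.2
  refine ⟨p, Polynomial.natDegree_le_iff_degree_le.2 (Polynomial.mem_degreeLE.1 hpd), ?_⟩
  intro r hr e he x hx
  have hrS : T r ∈ S := ⟨r, Polynomial.mem_degreeLE.2
    (Polynomial.natDegree_le_iff_degree_le.1 hr), rfl⟩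
  have he0 : 0 ≤ e := (abs_nonneg _).trans (he x hx)
  have h1 : ‖T r - f‖ ≤ e := by
    rw [ContinuousMap.norm_le _ he0]
    intro y
    exact he y y.2
  have h2 : ‖T p - f‖ ≤ e := by
    have h3 := hs ⟨T r, hrS⟩
    rw [← hps] at h3
    exact h3.trans h1
  exact (ContinuousMap.norm_le _ he0).1 h2 ⟨x, hx⟩

/-- The annealed ReLU `g_β(x) = log (1 + exp (β x)) / β`. -/
noncomputable def softplus (β x : ℝ) : ℝ := (1 / β) * Real.log (1 + Real.exp (β * x))

theorem continuous_softplus (β : ℝ) : Continuous (softplus β) := by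
  unfold softplus
  have h : ∀ x : ℝ, 1 + Real.exp (β * x) ≠ 0 := fun x => by positivity
  exact continuous_const.mul (Continuous.log (by fun_prop) h)

/-- The best uniform approximation of `g_β` on `[-1, 1]` of degree at most `d`. -/
noncomputable def softplusApprox (d : ℕ) (β : ℝ) : ℝ[X] :=
  Classical.choose (exists_isBestApprox (softplus β) (continuous_softplus β) d)

/-- The polynomial approximant of the ReLU `x ↦ max x 0` on `[-R, R]`, of degree at most `d`
and with relative shift `t`: it is `p(x) = 2 R q(x / (2 R) - t)`, where `q` is the best uniform
approximation of degree at most `d` of `g_β` on `[-1, 1]` for `β = √(π d / (4 t))`. -/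
noncomputable def reluPoly (d : ℕ) (t R : ℝ) : ℝ[X] :=
  C (2 * R) *
    (softplusApprox d (Real.sqrt (Real.pi * d / (4 * t)))).comp (C (1 / (2 * R)) * X - C t)

/-- The thresholding unit with threshold `τ` built from two copies of an activation `φ`.
For `φ = ReLU` and `τ ≥ 0` it is the soft threshold `x ↦ sgn x * max 0 (|x| - τ)`. -/
def thresholdUnit (φ : ℝ → ℝ) (τ x : ℝ) : ℝ := φ (x - τ) - φ (-x - τ)

/-- The two-layer network `x ↦ ⟨w, ρ(Aᵀ x)⟩`, where `ρ` is the thresholding unit with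
activation `φ` and threshold `τ`, applied coordinatewise. -/
def thresholdNetwork {n m : ℕ} (φ : ℝ → ℝ) (τ : ℝ) (A : Matrix (Fin n) (Fin m) ℝ)
    (w : Fin m → ℝ) (x : Fin n → ℝ) : ℝ :=
  w ⬝ᵥ fun j => thresholdUnit φ τ ((Aᵀ *ᵥ x) j)

/-- The estimator obtained from the network by replacing each ReLU with the polynomial
approximant with parameters `t = τ / (M + 2 τ)` and `R = M + 2 τ`. -/
noncomputable def polyEstimator {n m : ℕ} (d : ℕ) (τ M : ℝ) (A : Matrix (Fin n) (Fin m) ℝ)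
    (w : Fin m → ℝ) (x : Fin n → ℝ) : ℝ :=
  thresholdNetwork (fun y => (reluPoly d (τ / (M + 2 * τ)) (M + 2 * τ)).eval y) τ A w x

/-- `‖Aᵀ A - I‖_∞ ≤ μ` for the entrywise maximum norm. -/
def IsIncoherent {n m : ℕ} (A : Matrix (Fin n) (Fin m) ℝ) (μ : ℝ) : Prop :=
  ∀ i j, |(Aᵀ * A - (1 : Matrix (Fin m) (Fin m) ℝ)) i j| ≤ μ

/-- A subgaussian random vector with variance proxy `σ²`: every one-dimensional projection
`⟨u, ξ⟩` along a Euclidean unit vector `u` satisfies `E exp (t ⟨u, ξ⟩) ≤ exp (σ² t² / 2)`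
for all real `t`. -/
def IsSubgaussianVector {Ω : Type*} [MeasurableSpace Ω] {n : ℕ} (ξ : Ω → Fin n → ℝ) (σ : ℝ)
    (P : Measure Ω) : Prop :=
  ∀ u : Fin n → ℝ, ∑ i, u i ^ 2 = 1 →
    HasSubgaussianMGF (fun ω => u ⬝ᵥ ξ ω) (Real.toNNReal (σ ^ 2)) P

/-- The degree is at least `D` times the threshold degree. The first alternative is the
scale-invariant condition; the second one is the condition with `log² (M m / τ²)`, in the range
where that quantity dominates. -/
def DegreeAtLeast (D : ℝ) (m : ℕ) (τ M : ℝ) (d : ℕ) : Prop :=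
  D * ((2 + M / τ) * Real.log ((2 + M / τ) * m) ^ 2) ≤ d ∨
    (τ ≤ 1 ∧ τ ≤ M ∧ D * ((2 + M / τ) * Real.log (M * m / τ ^ 2) ^ 2) ≤ d)

/-!
The softplus function `g_β` extends holomorphically to the strip `|Im x| < π / β`, so Bernstein's
theorem (`exists_polynomial_approx_of_bernstein_ellipse`) on the ellipse of parameter `1 + 1 / β`
gives polynomials of degree at most `d` with uniform error `12 β (1 + 1 / β) ^ (-d)` on `[-1, 1]`.
For `β = √(π d / (4 t))` both this error and the tail `g_β (-t) ≤ exp (-β t) / β` decay like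
`exp (-c √(t d))`, up to a factor polynomial in `1 / t`. With `t = τ / (M + 2 τ)`, the degree
condition says that `√(t d) ≥ 8 log (m / t)` (`DegreeAtLeast.log_le_sqrt`), and both are
`O(t / m)` (`softplusApprox_bounds`).

Consequently the polynomial thresholding unit behaves on `[-M - τ, M + τ]` like a soft threshold at
level `3 τ`: it is `O(τ / m)` on `[-τ, τ]` (`abs_thresholdUnit_reluPoly_le`), and within `O(τ)` of
the identity elsewhere (`abs_thresholdUnit_reluPoly_sub_le`). Bernstein's theorem itself is proved
by expanding `θ ↦ G (cos θ)` in a Fourier series, whose coefficients decay geometrically because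
the circle of integration can be shifted inside the annulus that the Joukowski map sends onto the
ellipse.

On the probabilistic side, `Aᵀ X = Z + (Aᵀ A - 1) Z + Aᵀ ξ`. Incoherence bounds the second term by
`μ M ≤ τ / 2`, and a Chernoff bound with a union bound over the coordinates
(`IsSubgaussianVector.measureReal_exists_le`) bounds the third by `τ / 2` outside an event of
probability `m ^ (-q)`. On the good event the at most `k` active coordinates contribute `O(τ)` each
and the `m` inactive ones `O(τ / m)` each, so the estimator is within `O(k τ)` of `Y`
(`abs_dotProduct_thresholdUnit_sub_le`).
-/

/-! ### Bernstein's theorem on Chebyshev approximation -/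

/-- The Joukowski map, which sends the circles of radii `r` and `r⁻¹` to the Bernstein ellipse of
parameter `r` and restricts to `exp (i θ) ↦ cos θ` on the unit circle. -/
noncomputable def joukowski (z : ℂ) : ℂ := (z + z⁻¹) / 2

theorem differentiableAt_joukowski {z : ℂ} (hz : z ≠ 0) : DifferentiableAt ℂ joukowski z := by
  unfold joukowski
  fun_prop (disch := assumption)

theorem joukowski_exp (θ : ℝ) : joukowski (Complex.exp (θ * Complex.I)) = Real.cos θ := by
  rw [joukowski, ← Complex.exp_neg, Complex.ofReal_cos, Complex.cos]
  ring_nf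

/-- The coefficients of the Laurent expansion of a function holomorphic on the closed annulus
`ρ⁻¹ ≤ |z| ≤ ρ` decay geometrically: shift the circle of integration to the radius `ρ` for
`n ≥ 0` and to `ρ⁻¹` for `n < 0`. -/
theorem norm_circleIntegral_zpow_mul_le {H : ℂ → ℂ} {ρ B : ℝ} (hρ : 1 < ρ)
    (hd : ∀ z : ℂ, ρ⁻¹ ≤ ‖z‖ → ‖z‖ ≤ ρ → DifferentiableAt ℂ H z)
    (hB : ∀ z : ℂ, ρ⁻¹ ≤ ‖z‖ → ‖z‖ ≤ ρ → ‖H z‖ ≤ B) (n : ℤ) :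
    ‖∮ z in C(0, 1), (z - 0)⁻¹ • (z ^ (-n) * H z)‖ ≤ 2 * Real.pi * (B * ρ⁻¹ ^ n.natAbs) := by
  have hρ0 : 0 < ρ := by linarith
  have hρi : ρ⁻¹ < 1 := inv_lt_one_of_one_lt₀ hρ
  have hρi0 : 0 < ρ⁻¹ := by positivity
  have hd' : ∀ z : ℂ, ρ⁻¹ ≤ ‖z‖ → ‖z‖ ≤ ρ →
      DifferentiableAt ℂ (fun z => z ^ (-n) * H z) z := fun z h1 h2 => by
    have hz : z ≠ 0 := norm_pos_iff.1 (hρi0.trans_le h1)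
    exact (differentiableAt_zpow.2 (Or.inl hz)).mul (hd z h1 h2)
  have shift : ∀ r R : ℝ, ρ⁻¹ ≤ r → r ≤ R → R ≤ ρ →
      (∮ z in C(0, R), (z - 0)⁻¹ • (z ^ (-n) * H z)) =
        ∮ z in C(0, r), (z - 0)⁻¹ • (z ^ (-n) * H z) := fun r R h1 h2 h3 => by
    refine Complex.circleIntegral_sub_center_inv_smul_eq_of_differentiable_on_annulus_off_countable
      (hρi0.trans_le h1) h2 Set.countable_empty (fun z hz => ?_) (fun z hz => ?_)
    · simp only [Set.mem_sdiff, Metric.mem_closedBall, Metric.mem_ball, dist_zero_right,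
        not_lt] at hz
      exact (hd' z (by linarith) (by linarith)).continuousAt.continuousWithinAt
    · simp only [Set.mem_sdiff, Metric.mem_closedBall, Metric.mem_ball, dist_zero_right,
        not_le] at hz
      exact hd' z (by linarith [hz.1.2]) (by linarith [hz.1.1])
  have bound : ∀ r : ℝ, ρ⁻¹ ≤ r → r ≤ ρ →
      ‖∮ z in C(0, r), (z - 0)⁻¹ • (z ^ (-n) * H z)‖ ≤ 2 * Real.pi * (B * r ^ (-n)) := by
    intro r h1 h2
    have hr : 0 < r := hρi0.trans_le h1
    refine (circleIntegral.norm_integral_le_of_norm_le_const hr.le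
      (C := r⁻¹ * (r ^ (-n) * B)) fun z hz => ?_).trans_eq ?_
    · have hz' : ‖z‖ = r := by simpa using hz
      rw [sub_zero, norm_smul, norm_inv, norm_mul, norm_zpow, hz']
      gcongr
      exact hB z (by rw [hz']; exact h1) (by rw [hz']; exact h2)
    · field_simp
  rcases le_or_gt 0 n with hn | hn
  · rw [← shift 1 ρ hρi.le hρ.le le_rfl]
    refine (bound ρ (hρi.le.trans hρ.le) le_rfl).trans_eq ?_
    obtain ⟨k, rfl⟩ := Int.eq_ofNat_of_zero_le hn
    simp
  · rw [shift ρ⁻¹ 1 le_rfl hρi.le hρ.le]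
    refine (bound ρ⁻¹ le_rfl (hρi.le.trans hρ.le)).trans_eq ?_
    obtain ⟨k, hk⟩ := Int.eq_ofNat_of_zero_le (neg_nonneg.2 hn.le)
    obtain rfl : n = -k := by omega
    simp

instance : Fact (0 < 2 * Real.pi) := ⟨Real.two_pi_pos⟩

theorem fourierCoeff_two_pi_eq_circleIntegral (H : ℂ → ℂ) (n : ℤ) :
    fourierCoeff (fun x : AddCircle (2 * Real.pi) => H (AddCircle.toCircle x)) n =
      (1 / (2 * Real.pi * Complex.I)) * ∮ z in C(0, 1), (z - 0)⁻¹ • (z ^ (-n) * H z) := by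
  rw [fourierCoeff_eq_intervalIntegral _ _ 0, circleIntegral, zero_add]
  have h : ∀ θ : ℝ, deriv (circleMap 0 1) θ • ((circleMap 0 1 θ - 0)⁻¹ •
      (circleMap 0 1 θ ^ (-n) * H (circleMap 0 1 θ))) = Complex.I *
      (fourier (-n) (θ : AddCircle (2 * Real.pi)) •
        H (AddCircle.toCircle (θ : AddCircle (2 * Real.pi)))) := by
    intro θ
    have e1 : circleMap 0 1 θ = Complex.exp (θ * Complex.I) := by simp [circleMap]
    have e2 : ((AddCircle.toCircle (θ : AddCircle (2 * Real.pi)) : Circle) : ℂ) =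
        Complex.exp (θ * Complex.I) := by
      rw [AddCircle.toCircle_apply_mk, div_self Real.two_pi_pos.ne', one_mul, Circle.coe_exp]
    have e3 : fourier (-n) (θ : AddCircle (2 * Real.pi)) = Complex.exp (θ * Complex.I) ^ (-n) := by
      rw [fourier_apply, AddCircle.toCircle_zsmul, Circle.coe_zpow, e2]
    rw [deriv_circleMap, e3, e2, e1, smul_eq_mul, smul_eq_mul, smul_eq_mul, sub_zero]
    field_simp [Complex.exp_ne_zero]
  simp_rw [h]
  rw [intervalIntegral.integral_const_mul, Complex.real_smul]
  have := Real.pi_pos.ne'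
  push_cast
  field_simp

/-- **Bernstein's theorem**: a function holomorphic and bounded by `B` on the closed Bernstein
ellipse of parameter `ρ > 1` (the image of the annulus `ρ⁻¹ ≤ |z| ≤ ρ` under the Joukowski map)
is approximated on `[-1, 1]` by its truncated Chebyshev series, with geometrically small error. -/
theorem exists_polynomial_approx_of_bernstein_ellipse {G : ℂ → ℂ} {ρ B : ℝ} (hρ : 1 < ρ)
    (hd : ∀ z : ℂ, ρ⁻¹ ≤ ‖z‖ → ‖z‖ ≤ ρ → DifferentiableAt ℂ G (joukowski z))
    (hB : ∀ z : ℂ, ρ⁻¹ ≤ ‖z‖ → ‖z‖ ≤ ρ → ‖G (joukowski z)‖ ≤ B) (d : ℕ) :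
    ∃ p : ℝ[X], p.natDegree ≤ d ∧ ∀ x ∈ Set.Icc (-1 : ℝ) 1,
      |p.eval x - (G x).re| ≤ 2 * B * ρ⁻¹ ^ d / (ρ - 1) := by
  have hρ0 : 0 < ρ := by linarith
  have hρi : ρ⁻¹ < 1 := inv_lt_one_of_one_lt₀ hρ
  have hρi0 : 0 < ρ⁻¹ := by positivity
  set H : ℂ → ℂ := fun z => G (joukowski z) with hH
  have hHd : ∀ z : ℂ, ρ⁻¹ ≤ ‖z‖ → ‖z‖ ≤ ρ → DifferentiableAt ℂ H z := fun z h1 h2 =>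
    (hd z h1 h2).comp z (differentiableAt_joukowski (norm_pos_iff.1 (hρi0.trans_le h1)))
  let f : C(AddCircle (2 * Real.pi), ℂ) :=
    ⟨fun x => H (AddCircle.toCircle x), continuous_iff_continuousAt.2 fun x => by
      refine ContinuousAt.comp (f := fun x : AddCircle (2 * Real.pi) =>
        ((AddCircle.toCircle x : Circle) : ℂ)) (g := H) ?_ ?_
      · exact (hHd _ (by rw [Circle.norm_coe]; exact hρi.le)
          (by rw [Circle.norm_coe]; exact hρ.le)).continuousAt
      · exact (continuous_subtype_val.comp AddCircle.continuous_toCircle).continuousAt⟩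
  set c : ℤ → ℂ := fourierCoeff f with hc
  have hcb : ∀ n, ‖c n‖ ≤ B * ρ⁻¹ ^ n.natAbs := by
    intro n
    have h1 := norm_circleIntegral_zpow_mul_le hρ hHd hB n
    have h2 : c n = _ := fourierCoeff_two_pi_eq_circleIntegral H n
    have hpi := Real.pi_pos
    rw [h2, norm_mul]
    have h3 : ‖(1 / (2 * Real.pi * Complex.I) : ℂ)‖ = 1 / (2 * Real.pi) := by
      simp [abs_of_pos hpi]
    rw [h3, one_div, inv_mul_le_iff₀ (by positivity)]
    exact h1
  have hgeom : HasSum (fun k : ℕ => ρ⁻¹ ^ k) (1 - ρ⁻¹)⁻¹ :=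
    hasSum_geometric_of_lt_one hρi0.le hρi
  have hsumZ : Summable fun n : ℤ => B * ρ⁻¹ ^ n.natAbs := by
    apply Summable.mul_left
    refine Summable.of_nat_of_neg ?_ ?_ <;> simpa using hgeom.summable
  have hcs : Summable c := Summable.of_norm_bounded hsumZ hcb
  -- The cosine series of `θ ↦ Re (G (cos θ))`, an even function.
  have hcos : ∀ θ : ℝ, HasSum (fun n : ℤ => (c n).re * Real.cos (n * θ)) (G (Real.cos θ)).re := by
    intro θ
    have hf : ∀ θ : ℝ, HasSum (fun n : ℤ => c n * Complex.exp (n * θ * Complex.I))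
        (G (Real.cos θ)) := by
      intro θ
      have h := has_pointwise_sum_fourier_series_of_summable hcs (θ : AddCircle (2 * Real.pi))
      have e2 : ((AddCircle.toCircle (θ : AddCircle (2 * Real.pi)) : Circle) : ℂ) =
          Complex.exp (θ * Complex.I) := by
        rw [AddCircle.toCircle_apply_mk, div_self Real.two_pi_pos.ne', one_mul, Circle.coe_exp]
      have e3 : f (θ : AddCircle (2 * Real.pi)) = G (Real.cos θ) := by
        change G (joukowski _) = _
        rw [e2, joukowski_exp]
      rw [e3] at h
      convert h using 2 with n
      rw [fourier_apply, AddCircle.toCircle_zsmul, Circle.coe_zpow, e2, smul_eq_mul,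
        ← Complex.exp_int_mul, mul_assoc]
    have h1 := (hf θ).add (hf (-θ))
    rw [Real.cos_neg] at h1
    have h2 := Complex.hasSum_re (h1.mul_left (1 / 2))
    convert h2 using 1
    · funext n
      have : c n * Complex.exp (n * θ * Complex.I) +
          c n * Complex.exp (n * (-θ : ℝ) * Complex.I) = 2 * (c n * (Real.cos (n * θ) : ℝ)) := by
        rw [Complex.ofReal_cos, Complex.cos]
        push_cast
        ring_nf
      rw [this, ← mul_assoc, one_div, inv_mul_cancel₀ two_ne_zero, one_mul, Complex.re_mul_ofReal]
    · congr 1; ring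
  refine ⟨∑ n ∈ Finset.Icc (-d : ℤ) d, Polynomial.C (c n).re * Polynomial.Chebyshev.T ℝ n,
    ?_, ?_⟩
  · refine Polynomial.natDegree_sum_le_of_forall_le _ _ fun n hn => ?_
    refine (Polynomial.natDegree_C_mul_le _ _).trans ?_
    rw [Polynomial.Chebyshev.natDegree_T]
    rw [Finset.mem_Icc] at hn
    omega
  · intro x hx
    obtain ⟨θ, rfl⟩ : ∃ θ, x = Real.cos θ := ⟨Real.arccos x, (Real.cos_arccos hx.1 hx.2).symm⟩
    have h := hcos θ
    have hev : (∑ n ∈ Finset.Icc (-d : ℤ) d,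
        Polynomial.C (c n).re * Polynomial.Chebyshev.T ℝ n).eval (Real.cos θ) =
        ∑ n ∈ Finset.Icc (-d : ℤ) d, (c n).re * Real.cos (n * θ) := by
      simp [Polynomial.eval_finsetSum, Polynomial.Chebyshev.T_real_cos]
    have htail := (hasSum_sum_of_ne_finset_zero (f := fun n : ℤ =>
      if n ∈ Finset.Icc (-d : ℤ) d then (c n).re * Real.cos (n * θ) else 0)
      (s := Finset.Icc (-d : ℤ) d) fun n hn => if_neg hn).sub h
    rw [Finset.sum_congr rfl fun n hn => if_pos hn, ← hev] at htail
    -- The tail is dominated by two geometric series, one for each sign of the index.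
    have hdom : HasSum (fun n : ℤ => if n ∈ Finset.Icc (-d : ℤ) d then 0 else B * ρ⁻¹ ^ n.natAbs)
        (B * (ρ⁻¹ ^ (d + 1) * (1 - ρ⁻¹)⁻¹) + B * (ρ⁻¹ ^ (d + 1) * (1 - ρ⁻¹)⁻¹)) := by
      have hg := (hgeom.mul_left (ρ⁻¹ ^ (d + 1))).mul_left B
      refine HasSum.of_nat_of_neg_add_one ?_ ?_
      · refine (hasSum_nat_add_iff' (d + 1)).1 ?_
        rw [Finset.sum_eq_zero, sub_zero]
        · refine (congrArg (fun f => HasSum f _) (funext fun k => ?_)).mpr hg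
          rw [if_neg (by simp; omega), ← pow_add, Int.natAbs_natCast, add_comm]
        · intro k hk
          rw [Finset.mem_range] at hk
          exact if_pos (by simp; omega)
      · refine (hasSum_nat_add_iff' d).1 ?_
        rw [Finset.sum_eq_zero, sub_zero]
        · refine (congrArg (fun f => HasSum f _) (funext fun k => ?_)).mpr hg
          rw [if_neg (by simp; omega), ← pow_add]
          congr 2
          omega
        · intro k hk
          rw [Finset.mem_range] at hk
          exact if_pos (by simp; omega)
    refine (htail.norm_le_of_bounded hdom fun n => ?_).trans_eq ?_
    · split_ifs with hn
      · simp
      · rw [zero_sub, norm_neg, norm_mul]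
        refine (mul_le_of_le_one_right (norm_nonneg _) (Real.abs_cos_le_one _)).trans ?_
        exact (Complex.abs_re_le_norm _).trans (hcb n)
    · have h1 : ρ - 1 ≠ 0 := by linarith
      have h2 : ρ⁻¹ * (1 - ρ⁻¹)⁻¹ = (ρ - 1)⁻¹ := by field_simp
      rw [pow_succ, mul_assoc, h2]
      ring

/-! ### Approximation of the softplus function -/

/-- For `|Im u| ≤ 1 < π / 2` the number `1 + exp u` has real part at least `1`, which keeps it away
from the branch cut of the logarithm. -/
theorem norm_log_one_add_exp_le {u : ℂ} {b : ℝ} (hb : 0 ≤ b) (hre : u.re ≤ b) (him : |u.im| ≤ 1) :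
    1 + Complex.exp u ∈ Complex.slitPlane ∧
      ‖Complex.log (1 + Complex.exp u)‖ ≤ Real.log 2 + b + Real.pi := by
  have hpi : (1 : ℝ) ≤ Real.pi / 2 := by linarith [Real.pi_gt_three]
  have hcos : 0 ≤ Real.cos u.im :=
    Real.cos_nonneg_of_neg_pi_div_two_le_of_le (by linarith [(abs_le.1 him).1])
      (by linarith [(abs_le.1 him).2])
  have hre1 : 1 ≤ (1 + Complex.exp u).re := by
    rw [Complex.add_re, Complex.one_re, Complex.exp_re]
    nlinarith [mul_nonneg (Real.exp_pos u.re).le hcos]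
  have hn1 : 1 ≤ ‖1 + Complex.exp u‖ := hre1.trans (Complex.re_le_norm _)
  have hn2 : ‖1 + Complex.exp u‖ ≤ 2 * Real.exp b := by
    refine (norm_add_le _ _).trans ?_
    rw [norm_one, Complex.norm_exp]
    linarith [Real.exp_le_exp.2 hre, Real.one_le_exp hb]
  refine ⟨Or.inl (by linarith), (Complex.norm_le_abs_re_add_abs_im _).trans ?_⟩
  rw [Complex.log_re, Complex.log_im, abs_of_nonneg (Real.log_nonneg hn1)]
  refine add_le_add ?_ (Complex.abs_arg_le_pi _)
  refine (Real.log_le_log (by linarith) hn2).trans_eq ?_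
  rw [Real.log_mul two_ne_zero (Real.exp_ne_zero _), Real.log_exp]

/-- The softplus function extends holomorphically to the strip `|Im x| < π / β`, which contains
the Bernstein ellipse of parameter `1 + 1 / β`. -/
theorem exists_polynomial_approx_softplus {β : ℝ} (hβ : 1 ≤ β) (d : ℕ) :
    ∃ p : ℝ[X], p.natDegree ≤ d ∧ ∀ x ∈ Set.Icc (-1 : ℝ) 1,
      |p.eval x - softplus β x| ≤ 12 * β * (1 + 1 / β)⁻¹ ^ d := by
  have hβ0 : 0 < β := by linarith
  set δ : ℝ := 1 / β with hδ
  have hδ0 : 0 < δ := by positivity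
  have hδ1 : δ ≤ 1 := by rw [hδ, div_le_one hβ0]; exact hβ
  have hβδ : β * δ = 1 := by rw [hδ]; field_simp
  let G : ℂ → ℂ := fun w => (1 / β) * Complex.log (1 + Complex.exp (β * w))
  have hbound : ∀ z : ℂ, (1 + δ)⁻¹ ≤ ‖z‖ → ‖z‖ ≤ 1 + δ →
      (β * joukowski z).re ≤ 2 * β ∧ |(β * joukowski z).im| ≤ 1 := by
    intro z h1 h2
    have hz : 0 < ‖z‖ := lt_of_lt_of_le (by positivity) h1
    have hi1 : ‖z‖⁻¹ ≤ 1 + δ := inv_le_of_inv_le₀ (by positivity) h1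
    have hj : ‖joukowski z‖ ≤ 2 := by
      rw [joukowski, norm_div, Complex.norm_ofNat, div_le_iff₀ two_pos]
      refine (norm_add_le _ _).trans ?_
      rw [norm_inv]
      linarith
    have him : |(joukowski z).im| ≤ δ := by
      have e : (joukowski z).im = z.im / ‖z‖ * ((‖z‖ - ‖z‖⁻¹) / 2) := by
        rw [joukowski, Complex.div_ofNat_im, Complex.add_im, Complex.inv_im,
          Complex.normSq_eq_norm_sq]
        field_simp
        ring
      have hδi : 1 - δ ≤ (1 + δ)⁻¹ := by
        rw [← one_div, le_div_iff₀ (by positivity)]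
        nlinarith
      rw [e, abs_mul, abs_div, abs_norm]
      have h3 : |z.im| / ‖z‖ ≤ 1 := by
        rw [div_le_one hz]; exact Complex.abs_im_le_norm z
      have h4 : |(‖z‖ - ‖z‖⁻¹) / 2| ≤ δ := by
        have h5 : 1 - δ ≤ ‖z‖⁻¹ := hδi.trans (inv_anti₀ hz h2)
        rw [abs_le]; constructor <;> linarith
      calc _ ≤ 1 * δ := mul_le_mul h3 h4 (abs_nonneg _) zero_le_one
        _ = δ := one_mul δ
    rw [Complex.re_ofReal_mul, Complex.im_ofReal_mul, abs_mul, abs_of_pos hβ0]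
    constructor
    · nlinarith [(Complex.re_le_norm (joukowski z)).trans hj]
    · nlinarith
  obtain ⟨p, hp, hpe⟩ := exists_polynomial_approx_of_bernstein_ellipse (G := G) (ρ := 1 + δ)
    (B := 6) (by linarith) (fun z h1 h2 => by
      have hb := hbound z h1 h2
      have hs := (norm_log_one_add_exp_le (by positivity) hb.1 hb.2).1
      have : DifferentiableAt ℂ (fun w : ℂ => 1 + Complex.exp (β * w)) (joukowski z) := by fun_prop
      exact (this.clog hs).const_mul _)
    (fun z h1 h2 => by
      have hb := hbound z h1 h2
      have hs := (norm_log_one_add_exp_le (by positivity) hb.1 hb.2).2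
      have hn : ‖(1 / β : ℂ)‖ = 1 / β := by simp [abs_of_pos hβ0]
      change ‖(1 / β : ℂ) * _‖ ≤ 6
      rw [norm_mul, hn, one_div, inv_mul_le_iff₀ hβ0]
      nlinarith [Real.log_two_lt_d9, Real.pi_lt_d2]) d
  refine ⟨p, hp, fun x hx => ?_⟩
  have h := hpe x hx
  have e1 : (G x).re = softplus β x := by
    have : G x = (softplus β x : ℝ) := by
      simp only [G, softplus]
      push_cast
      rw [Complex.ofReal_log (by positivity)]
      push_cast
      rfl
    rw [this, Complex.ofReal_re]
  rw [e1] at h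
  refine h.trans_eq ?_
  rw [add_sub_cancel_left, hδ]
  field_simp
  norm_num

theorem softplus_nonneg {β : ℝ} (hβ : 0 < β) (x : ℝ) : 0 ≤ softplus β x :=
  mul_nonneg (by positivity) (Real.log_nonneg (by linarith [Real.exp_pos (β * x)]))

theorem softplus_le_exp {β : ℝ} (hβ : 0 < β) (x : ℝ) :
    softplus β x ≤ (1 / β) * Real.exp (β * x) := by
  unfold softplus
  gcongr
  have := Real.log_le_sub_one_of_pos (x := 1 + Real.exp (β * x)) (by positivity)
  linarith

theorem abs_softplus_sub_max_le {β : ℝ} (hβ : 0 < β) (x : ℝ) :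
    |softplus β x - max x 0| ≤ 1 / β := by
  have h0 : 0 ≤ 1 / β := by positivity
  rcases le_total x 0 with hx | hx
  · rw [max_eq_right hx, sub_zero, abs_of_nonneg (softplus_nonneg hβ x)]
    refine (softplus_le_exp hβ x).trans (mul_le_of_le_one_right h0 ?_)
    exact Real.exp_le_one_iff.2 (mul_nonpos_of_nonneg_of_nonpos hβ.le hx)
  · have e : softplus β x = x + softplus β (-x) := by
      have : 1 + Real.exp (β * x) = Real.exp (β * x) * (1 + Real.exp (β * -x)) := by
        rw [mul_add, mul_one, ← Real.exp_add]
        simp [add_comm]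
      unfold softplus
      rw [this, Real.log_mul (by positivity) (by positivity), Real.log_exp]
      field_simp
    rw [max_eq_left hx, e, add_sub_cancel_left, abs_of_nonneg (softplus_nonneg hβ _)]
    refine (softplus_le_exp hβ _).trans (mul_le_of_le_one_right h0 ?_)
    exact Real.exp_le_one_iff.2 (mul_nonpos_of_nonneg_of_nonpos hβ.le (by linarith))

theorem softplusApprox_spec (d : ℕ) (β : ℝ) : IsBestApprox (softplus β) d (softplusApprox d β) :=
  Classical.choose_spec (exists_isBestApprox (softplus β) (continuous_softplus β) d)

/-- In terms of `s = √(t d)`, the best approximation error of `g_β` for `β = √(π d / (4 t))` is at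
most `(48 / t) exp (-s / 4)`: here `β ≤ s / t` and `d / β = 2 s / √π ≥ s`. -/
theorem abs_softplusApprox_sub_le {d : ℕ} {t β : ℝ} (hd : 1 ≤ d) (ht : 0 < t) (ht2 : t ≤ 1 / 2)
    (hβ : β = Real.sqrt (Real.pi * d / (4 * t))) {x : ℝ} (hx : x ∈ Set.Icc (-1 : ℝ) 1) :
    |(softplusApprox d β).eval x - softplus β x| ≤ 48 / t * Real.exp (-Real.sqrt (t * d) / 4) := by
  have hd0 : (1 : ℝ) ≤ d := by exact_mod_cast hd
  have hpi := Real.pi_gt_three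
  set s := Real.sqrt (t * d) with hs
  have hs0 : 0 < s := Real.sqrt_pos.2 (by positivity)
  have hs2 : s ^ 2 = t * d := Real.sq_sqrt (by positivity)
  have hβ1 : 1 ≤ β := by
    rw [hβ, Real.one_le_sqrt, le_div_iff₀ (by positivity)]
    nlinarith
  have hβ0 : 0 < β := by linarith
  have hβs : β ≤ s / t := by
    rw [hβ]
    refine Real.sqrt_le_iff.2 ⟨by positivity, ?_⟩
    rw [div_pow, hs2, div_le_div_iff₀ (by positivity) (by positivity)]
    have : Real.pi * (d * t ^ 2) ≤ 4 * (d * t ^ 2) := by gcongr; exact Real.pi_lt_four.le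
    nlinarith
  have hdβ : s ≤ d / β := by
    rw [le_div_iff₀ hβ0]
    calc s * β ≤ s * (s / t) := by gcongr
      _ = d := by rw [← mul_div_assoc, ← sq, hs2]; field_simp
  obtain ⟨p, hp, hpe⟩ := exists_polynomial_approx_softplus hβ1 d
  refine ((softplusApprox_spec d β).2 p hp _ hpe x hx).trans ?_
  have hbase : (1 + 1 / β)⁻¹ ≤ Real.exp (-(1 / β / 2)) := by
    have h1 : 1 / β ≤ 1 := by rw [div_le_one hβ0]; exact hβ1
    have h2 : 0 < 1 / β := by positivity
    refine le_trans ?_ (Real.one_sub_le_exp_neg _)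
    rw [inv_le_iff_one_le_mul₀ (by positivity)]
    nlinarith
  have hpow : (1 + 1 / β)⁻¹ ^ d ≤ Real.exp (-(s / 2)) := by
    refine (pow_le_pow_left₀ (by positivity) hbase d).trans ?_
    rw [← Real.exp_nat_mul, Real.exp_le_exp]
    have : (d : ℝ) * -(1 / β / 2) = -(d / β / 2) := by ring
    linarith
  have hsexp : s ≤ 4 * Real.exp (s / 4) := by linarith [Real.add_one_le_exp (s / 4)]
  calc 12 * β * (1 + 1 / β)⁻¹ ^ d ≤ 12 * (4 * Real.exp (s / 4) / t) * Real.exp (-(s / 2)) := by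
        gcongr
        exact hβs.trans (by gcongr)
    _ = 48 / t * (Real.exp (s / 4) * Real.exp (-(s / 2))) := by ring
    _ = 48 / t * Real.exp (-s / 4) := by rw [← Real.exp_add]; ring_nf

/-! ### The degree condition -/

/-- Both alternatives of the degree condition say that `√(t d)` exceeds a multiple of
`log (m / t)` for the relative shift `t = τ / (M + 2 τ)`. -/
theorem DegreeAtLeast.log_le_sqrt {m d : ℕ} {τ M : ℝ} (hm : 2 ≤ m) (hτ : 0 < τ) (hM : 0 ≤ M)
    (h : DegreeAtLeast 576 m τ M d) :
    8 * Real.log (m / (τ / (M + 2 * τ))) ≤ Real.sqrt (τ / (M + 2 * τ) * d) := by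
  have hm' : (2 : ℝ) ≤ m := by exact_mod_cast hm
  have hR : 0 < M + 2 * τ := by positivity
  have hr : 2 + M / τ = (M + 2 * τ) / τ := by field_simp; ring
  have hr2 : 2 ≤ 2 + M / τ := le_add_of_nonneg_right (by positivity)
  have e1 : m / (τ / (M + 2 * τ)) = (2 + M / τ) * m := by rw [hr]; field_simp
  -- The constant is `576 = 24²`; the slack `24 = 3 * 8` pays for the second alternative.
  have key : ∀ L : ℝ, 0 ≤ L → 576 * ((2 + M / τ) * L ^ 2) ≤ d →
      24 * L ≤ Real.sqrt (τ / (M + 2 * τ) * d) := by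
    intro L hL hd
    refine Real.le_sqrt_of_sq_le ?_
    calc (24 * L) ^ 2 = τ / (M + 2 * τ) * (576 * ((2 + M / τ) * L ^ 2)) := by
          rw [hr]; field_simp; ring
      _ ≤ _ := by gcongr
  rw [e1]
  rcases h with h | ⟨h1, h2, h3⟩
  · have hL : 0 ≤ Real.log ((2 + M / τ) * m) := Real.log_nonneg (by nlinarith)
    linarith [key _ hL h]
  · have hu : 2 ≤ M * m / τ ^ 2 := by
      rw [le_div_iff₀ (by positivity)]
      nlinarith [mul_le_mul h2 hm' zero_le_two hM]
    have hlog : Real.log 2 ≤ Real.log (M * m / τ ^ 2) := Real.log_le_log two_pos hu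
    -- Since `1 ≤ M / τ` and `τ ≤ 1`, the quantity `(2 + M / τ) m` is at most `4 (M m / τ²)`.
    have hle : Real.log ((2 + M / τ) * m) ≤ 3 * Real.log (M * m / τ ^ 2) := by
      have h5 : (2 + M / τ) * m ≤ 2 ^ 2 * (M * m / τ ^ 2) := by
        have h6 : 1 ≤ M / τ := by rwa [one_le_div hτ]
        have h7 : M / τ * m ≤ M * m / τ ^ 2 := by
          rw [div_mul_eq_mul_div, div_le_div_iff_of_pos_left] <;> nlinarith
        nlinarith
      refine (Real.log_le_log (by positivity) h5).trans ?_
      rw [Real.log_mul (by positivity) (by linarith), Real.log_pow]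
      push_cast
      linarith
    have hL : 0 ≤ Real.log (M * m / τ ^ 2) := Real.log_nonneg (by linarith)
    linarith [key _ hL h3]

/-! ### The polynomial thresholding unit -/

section ThresholdUnit

variable {d m : ℕ} {τ M : ℝ}

theorem eval_reluPoly (d : ℕ) (t R y : ℝ) : (reluPoly d t R).eval y =
    2 * R * (softplusApprox d (Real.sqrt (Real.pi * d / (4 * t)))).eval (1 / (2 * R) * y - t) := by
  simp [reluPoly]

theorem natDegree_reluPoly_le (d : ℕ) (t R : ℝ) : (reluPoly d t R).natDegree ≤ d := by
  refine (natDegree_C_mul_le _ _).trans (natDegree_comp_le.trans ?_)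
  refine (Nat.mul_le_mul (softplusApprox_spec d _).1 (?_ : _ ≤ 1)).trans_eq (mul_one d)
  refine (natDegree_sub_le _ _).trans ?_
  rw [natDegree_C, max_eq_left (Nat.zero_le _)]
  exact (natDegree_C_mul_le _ _).trans natDegree_X_le

/-- Consequences of `√(t d) ≥ 8 log (m / t)` for `β = √(π d / (4 t))`: both the polynomial
approximation error of `g_β` and its values on `(-∞, -t]` are `O(t / m)`. -/
theorem softplusApprox_bounds {t : ℝ} (hm : 2 ≤ m) (ht : 0 < t) (ht2 : t ≤ 1 / 2)
    (h : 8 * Real.log (m / t) ≤ Real.sqrt (t * d)) {β : ℝ}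
    (hβ : β = Real.sqrt (Real.pi * d / (4 * t))) :
    0 < β ∧ 1 / β ≤ t ∧
    (∀ y ∈ Set.Icc (-1 : ℝ) 1, |(softplusApprox d β).eval y - softplus β y| ≤ 48 * (t / m)) ∧
    ∀ y ≤ -t, softplus β y ≤ t / m := by
  have hm' : (2 : ℝ) ≤ m := by exact_mod_cast hm
  have hmt : 4 ≤ m / t := by rw [le_div_iff₀ ht]; linarith
  have hlog : 1 ≤ Real.log (m / t) := by
    rw [Real.le_log_iff_exp_le (by positivity)]
    linarith [Real.exp_one_lt_d9]
  have hd : 1 ≤ d := by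
    by_contra hd
    obtain rfl : d = 0 := by omega
    simp only [Nat.cast_zero, mul_zero, Real.sqrt_zero] at h
    linarith
  have hd0 : (1 : ℝ) ≤ d := by exact_mod_cast hd
  have herr := fun y (hy : y ∈ Set.Icc (-1 : ℝ) 1) => abs_softplusApprox_sub_le hd ht ht2 hβ hy
  have hβ0 : 0 < β := by rw [hβ]; exact Real.sqrt_pos.2 (by positivity)
  have hβt : Real.sqrt (t * d) / 2 ≤ β * t := by
    refine le_of_sq_le_sq ?_ (by positivity)
    rw [div_pow, mul_pow, hβ, Real.sq_sqrt (by positivity), Real.sq_sqrt (by positivity)]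
    have e : Real.pi * d / (4 * t) * t ^ 2 = Real.pi / 4 * (t * d) := by field_simp
    rw [e]
    nlinarith [Real.pi_gt_three, mul_pos ht (show (0 : ℝ) < d by linarith)]
  set s := Real.sqrt (t * d)
  have hexp : Real.exp (-s / 4) ≤ (t / m) ^ 2 := by
    rw [← Real.le_log_iff_exp_le (by positivity), Real.log_pow, ← inv_div (m : ℝ) t, Real.log_inv]
    push_cast
    linarith
  have htm : t / m ≤ 1 := by rw [div_le_one (by linarith)]; linarith
  have htm0 : 0 < t / m := by positivity
  have hinv : 1 / β ≤ t := by
    rw [div_le_iff₀ hβ0]; linarith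
  refine ⟨hβ0, hinv, fun y hy => (herr y hy).trans ?_, fun y hy => ?_⟩
  · calc 48 / t * Real.exp (-s / 4) ≤ 48 / t * (t / m) ^ 2 := by gcongr
      _ = 48 * (t / m) * (1 / m) := by field_simp
      _ ≤ 48 * (t / m) * 1 := by
        gcongr
        rw [div_le_one (by linarith)]; linarith
      _ = _ := mul_one _
  · have hy2 : β * y ≤ -s / 4 := by
      have := mul_le_mul_of_nonneg_left hy hβ0.le
      linarith
    calc softplus β y ≤ 1 / β * Real.exp (β * y) := softplus_le_exp hβ0 y
      _ ≤ 1 * (t / m) ^ 2 := by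
        gcongr
        · linarith
        · exact (Real.exp_le_exp.2 hy2).trans hexp
      _ ≤ t / m := by nlinarith

theorem abs_softThreshold_sub_le {s : ℝ} (hs : 0 ≤ s) (x : ℝ) :
    |max (x - s) 0 - max (-x - s) 0 - x| ≤ s := by
  rw [abs_le]
  rcases max_cases (x - s) 0 with ⟨e1, _⟩ | ⟨e1, _⟩ <;>
    rcases max_cases (-x - s) 0 with ⟨e2, _⟩ | ⟨e2, _⟩ <;>
    rw [e1, e2] <;> constructor <;> linarith

/-- With `g = g_β`, `R = M + 2 τ` and `t = τ / R`, the polynomial thresholding unit at `x` is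
`2 R (q (a x) - q (a (-x)))`, where `q` approximates `g` and `2 R a x = x - 3 τ`. -/
theorem exists_thresholdUnit_reluPoly_eq (hτ : 0 < τ) (hM : 0 ≤ M) {x : ℝ} (hx : |x| ≤ M + τ) :
    ∃ a ∈ Set.Icc (-1 : ℝ) 1, ∃ b ∈ Set.Icc (-1 : ℝ) 1,
      2 * (M + 2 * τ) * a = x - 3 * τ ∧ 2 * (M + 2 * τ) * b = -x - 3 * τ ∧
      thresholdUnit (fun y => (reluPoly d (τ / (M + 2 * τ)) (M + 2 * τ)).eval y) τ x =
        2 * (M + 2 * τ) *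
          ((softplusApprox d (Real.sqrt (Real.pi * d / (4 * (τ / (M + 2 * τ)))))).eval a -
            (softplusApprox d (Real.sqrt (Real.pi * d / (4 * (τ / (M + 2 * τ)))))).eval b) := by
  have hR : 0 < M + 2 * τ := by positivity
  have e : ∀ x : ℝ, 1 / (2 * (M + 2 * τ)) * (x - τ) - τ / (M + 2 * τ) =
      (x - 3 * τ) / (2 * (M + 2 * τ)) := fun x => by field_simp; ring
  have hmem : ∀ x : ℝ, |x| ≤ M + τ → (x - 3 * τ) / (2 * (M + 2 * τ)) ∈ Set.Icc (-1 : ℝ) 1 := by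
    intro x hx
    obtain ⟨h1, h2⟩ := abs_le.1 hx
    rw [Set.mem_Icc, le_div_iff₀ (by positivity), div_le_iff₀ (by positivity)]
    constructor <;> linarith
  refine ⟨_, hmem x hx, _, hmem (-x) (by rwa [abs_neg]), mul_div_cancel₀ _ (by positivity),
    mul_div_cancel₀ _ (by positivity), ?_⟩
  simp only [thresholdUnit, eval_reluPoly, e]
  ring

/-- The polynomial thresholding unit is small on the noise: on `|x| ≤ τ` both arguments of `g_β`
are at most `-t`, where `g_β` is exponentially small. -/
theorem abs_thresholdUnit_reluPoly_le (hm : 2 ≤ m) (hτ : 0 < τ) (hM : 0 ≤ M)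
    (h : 8 * Real.log (m / (τ / (M + 2 * τ))) ≤ Real.sqrt (τ / (M + 2 * τ) * d))
    {x : ℝ} (hx : |x| ≤ τ) :
    |thresholdUnit (fun y => (reluPoly d (τ / (M + 2 * τ)) (M + 2 * τ)).eval y) τ x| ≤
      194 * (τ / m) := by
  obtain ⟨a, ha, b, hb, ha', hb', hu⟩ := exists_thresholdUnit_reluPoly_eq (d := d) hτ hM
    (hx.trans (le_add_of_nonneg_left hM))
  rw [hu]
  clear hu
  set R := M + 2 * τ
  have hR : 0 < R := by positivity
  have hRt : R * (τ / R) = τ := mul_div_cancel₀ _ hR.ne'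
  obtain ⟨hβ0, -, herr, hsmall⟩ := softplusApprox_bounds (d := d) hm (by positivity : 0 < τ / R)
    (by rw [div_le_div_iff₀ hR two_pos]; linarith) h rfl
  set β := Real.sqrt (Real.pi * d / (4 * (τ / R)))
  set t := τ / R
  have hle : ∀ y : ℝ, 2 * R * y ≤ -(2 * τ) → y ≤ -t := fun y hy => by
    refine le_of_mul_le_mul_left (?_ : 2 * R * y ≤ 2 * R * -t) (by positivity)
    linarith
  obtain ⟨h1, h2⟩ := abs_le.1 hx
  have h3 := hsmall a (hle a (by linarith))
  have h4 := hsmall b (hle b (by linarith))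
  have h5 := softplus_nonneg hβ0 a
  have h6 := softplus_nonneg hβ0 b
  have hea := abs_le.1 (herr a ha)
  have heb := abs_le.1 (herr b hb)
  have h7 : |(softplusApprox d β).eval a - (softplusApprox d β).eval b| ≤ 97 * (t / m) := by
    rw [abs_le]
    constructor <;> linarith only [hea.1, hea.2, heb.1, heb.2, h3, h4, h5, h6]
  rw [abs_mul, abs_of_pos (by positivity : 0 < 2 * R)]
  calc _ ≤ 2 * R * (97 * (t / m)) := mul_le_mul_of_nonneg_left h7 (by positivity)
    _ = 194 * (R * t / m) := by ring
    _ = _ := by rw [hRt]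

/-- On the whole range of the network, the polynomial thresholding unit is close to the soft
threshold at level `3 τ`, hence to the identity. -/
theorem abs_thresholdUnit_reluPoly_sub_le (hm : 2 ≤ m) (hτ : 0 < τ) (hM : 0 ≤ M)
    (h : 8 * Real.log (m / (τ / (M + 2 * τ))) ≤ Real.sqrt (τ / (M + 2 * τ) * d))
    {x z : ℝ} (hx : |x| ≤ M + τ) (hz : |x - z| ≤ τ) :
    |thresholdUnit (fun y => (reluPoly d (τ / (M + 2 * τ)) (M + 2 * τ)).eval y) τ x - z| ≤
      200 * τ := by
  have hm' : (2 : ℝ) ≤ m := by exact_mod_cast hm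
  obtain ⟨a, ha, b, hb, ha', hb', hu⟩ := exists_thresholdUnit_reluPoly_eq (d := d) hτ hM hx
  rw [hu]
  clear hu
  set R := M + 2 * τ
  have hR : 0 < R := by positivity
  have hRt : R * (τ / R) = τ := mul_div_cancel₀ _ hR.ne'
  obtain ⟨hβ0, hinv, herr, -⟩ := softplusApprox_bounds (d := d) hm (by positivity : 0 < τ / R)
    (by rw [div_le_div_iff₀ hR two_pos]; linarith) h rfl
  set β := Real.sqrt (Real.pi * d / (4 * (τ / R)))
  set t := τ / R
  have hea := abs_le.1 (herr a ha)
  have heb := abs_le.1 (herr b hb)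
  have h1 := abs_le.1 (abs_softplus_sub_max_le hβ0 a)
  have h2 := abs_le.1 (abs_softplus_sub_max_le hβ0 b)
  have h3 : |(softplusApprox d β).eval a - (softplusApprox d β).eval b -
      (max a 0 - max b 0)| ≤ 96 * (t / m) + 2 * t := by
    rw [abs_le]
    constructor <;> linarith only [hea.1, hea.2, heb.1, heb.2, h1.1, h1.2, h2.1, h2.2, hinv]
  have h4 : |2 * R * ((softplusApprox d β).eval a - (softplusApprox d β).eval b) -
      (max (x - 3 * τ) 0 - max (-x - 3 * τ) 0)| ≤ 192 * (τ / m) + 4 * τ := by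
    have e : ∀ y : ℝ, max (2 * R * y) 0 = 2 * R * max y 0 := fun y => by
      rw [mul_max_of_nonneg _ _ (by positivity : 0 ≤ 2 * R), mul_zero]
    rw [← ha', ← hb', e, e, ← mul_sub, ← mul_sub, abs_mul,
      abs_of_pos (by positivity : 0 < 2 * R)]
    calc _ ≤ 2 * R * (96 * (t / m) + 2 * t) := mul_le_mul_of_nonneg_left h3 (by positivity)
      _ = 192 * (R * t / m) + 4 * (R * t) := by ring
      _ = _ := by rw [hRt]
  have h5 := abs_softThreshold_sub_le (by positivity : 0 ≤ 3 * τ) x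
  have hτm : τ / m ≤ τ / 2 := div_le_div_of_nonneg_left hτ.le two_pos hm'
  rw [abs_le] at h4 h5 hz ⊢
  constructor <;> linarith only [h4.1, h4.2, h5.1, h5.2, hz.1, hz.2, hτm, hτ]

/-! ### The network on sparse signals -/

/-- On a sparse signal observed with coordinatewise noise at most `τ`, the active coordinates
contribute an error `O(τ)` each, and the remaining ones an error `O(τ / m)` each. -/
theorem abs_dotProduct_thresholdUnit_sub_le {k : ℕ} (hk : 1 ≤ k) (hm : 2 ≤ m) (hτ : 0 < τ)
    (hM : 0 ≤ M) (h : 8 * Real.log (m / (τ / (M + 2 * τ))) ≤ Real.sqrt (τ / (M + 2 * τ) * d))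
    {w x z : Fin m → ℝ} (hw : ‖w‖ ≤ 1) (hxz : ∀ j, |x j - z j| ≤ τ) (hz : ∑ j, |z j| ≤ M)
    (hzk : (Function.support z).ncard ≤ k) :
    |(w ⬝ᵥ fun j =>
        thresholdUnit (fun y => (reluPoly d (τ / (M + 2 * τ)) (M + 2 * τ)).eval y) τ (x j)) -
      w ⬝ᵥ z| ≤ 400 * (k * τ) := by
  set u : Fin m → ℝ := fun j =>
    thresholdUnit (fun y => (reluPoly d (τ / (M + 2 * τ)) (M + 2 * τ)).eval y) τ (x j)
  have hm0 : (0 : ℝ) < m := by exact_mod_cast (by omega : 0 < m)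
  have hj : ∀ j, |u j - z j| ≤ 194 * (τ / m) + if z j ≠ 0 then 200 * τ else 0 := by
    intro j
    have hzj : |z j| ≤ M := (Finset.single_le_sum (f := fun j => |z j|)
      (fun i _ => abs_nonneg _) (Finset.mem_univ j)).trans hz
    have hxj : |x j| ≤ M + τ := by
      calc |x j| = |z j + (x j - z j)| := by ring_nf
        _ ≤ _ := (abs_add_le _ _).trans (add_le_add hzj (hxz j))
    split_ifs with h0
    · have : 0 ≤ 194 * (τ / m) := by positivity
      linarith [abs_thresholdUnit_reluPoly_sub_le hm hτ hM h hxj (hxz j)]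
    · rw [not_not] at h0
      have h1 := hxz j
      rw [h0, sub_zero] at h1 ⊢
      linarith [abs_thresholdUnit_reluPoly_le hm hτ hM h h1]
  have hcard : ((Finset.univ.filter fun j => z j ≠ 0).card : ℝ) ≤ k := by
    rw [← Set.ncard_coe_finset]
    refine le_trans (le_of_eq ?_) (Nat.cast_le.2 hzk)
    congr 2
    ext j
    simp
  have hk' : (1 : ℝ) ≤ k := by exact_mod_cast hk
  rw [← dotProduct_sub, dotProduct]
  calc |∑ j, w j * (u - z) j| ≤ ∑ j, |w j * (u - z) j| := Finset.abs_sum_le_sum_abs _ _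
    _ ≤ ∑ j, (194 * (τ / m) + if z j ≠ 0 then 200 * τ else 0) := by
      refine Finset.sum_le_sum fun j _ => ?_
      rw [abs_mul]
      refine (mul_le_of_le_one_left (abs_nonneg _) ?_).trans (hj j)
      exact (norm_le_pi_norm w j).trans hw
    _ = 194 * τ + (Finset.univ.filter fun j => z j ≠ 0).card * (200 * τ) := by
      rw [Finset.sum_add_distrib, Finset.sum_const, ← Finset.sum_filter, Finset.sum_const,
        Finset.card_univ, Fintype.card_fin, nsmul_eq_mul, nsmul_eq_mul]
      field_simp
    _ ≤ 194 * (k * τ) + k * (200 * τ) := by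
      gcongr
      nlinarith
    _ ≤ 400 * (k * τ) := by nlinarith [mul_pos (by linarith : (0 : ℝ) < k) hτ]

end ThresholdUnit

/-! ### The network is a polynomial -/

/-- Substituting a polynomial of degree at most one does not raise the degree. -/
theorem totalDegree_aeval_le {ι : Type*} (p : ℝ[X]) {L : MvPolynomial ι ℝ}
    (hL : L.totalDegree ≤ 1) : (aeval L p).totalDegree ≤ p.natDegree := by
  rw [aeval_eq_sum_range]
  refine MvPolynomial.totalDegree_finsetSum_le fun i hi => ?_
  refine (MvPolynomial.totalDegree_smul_le _ _).trans
    ((MvPolynomial.totalDegree_pow _ _).trans ?_)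
  rw [Finset.mem_range] at hi
  calc i * L.totalDegree ≤ i * 1 := Nat.mul_le_mul_left _ hL
    _ ≤ _ := by omega

theorem exists_mvPolynomial_eq_thresholdNetwork {n m : ℕ} (p : ℝ[X]) (τ : ℝ)
    (A : Matrix (Fin n) (Fin m) ℝ) (w : Fin m → ℝ) :
    ∃ F : MvPolynomial (Fin n) ℝ, F.totalDegree ≤ p.natDegree ∧
      ∀ x, MvPolynomial.eval x F = thresholdNetwork (fun y => p.eval y) τ A w x := by
  let L : Fin m → MvPolynomial (Fin n) ℝ := fun j => ∑ i, MvPolynomial.C (A i j) * MvPolynomial.X i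
  have hL : ∀ j, (L j).totalDegree ≤ 1 := fun j =>
    MvPolynomial.totalDegree_finsetSum_le fun i _ => by
      refine (MvPolynomial.totalDegree_mul _ _).trans ?_
      simp
  have hLx : ∀ x j, MvPolynomial.eval x (L j) = (Aᵀ *ᵥ x) j := fun x j => by
    simp [L, Matrix.mulVec, dotProduct]
  have hev : ∀ (x : Fin n → ℝ) (G : MvPolynomial (Fin n) ℝ),
      MvPolynomial.eval x (aeval G p) = p.eval (MvPolynomial.eval x G) := fun x G => by
    rw [aeval_def, hom_eval₂, eval, MvPolynomial.algebraMap_eq]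
    congr 1
    ext r
    simp
  refine ⟨∑ j, MvPolynomial.C (w j) * (aeval (L j - MvPolynomial.C τ) p -
    aeval (-L j - MvPolynomial.C τ) p), ?_, fun x => ?_⟩
  · refine MvPolynomial.totalDegree_finsetSum_le fun j _ => ?_
    refine (MvPolynomial.totalDegree_mul _ _).trans ?_
    rw [MvPolynomial.totalDegree_C, zero_add]
    refine (MvPolynomial.totalDegree_sub _ _).trans (max_le ?_ ?_) <;>
      refine totalDegree_aeval_le p ((MvPolynomial.totalDegree_sub_C_le _ _).trans ?_)
    · exact hL j
    · rw [MvPolynomial.totalDegree_neg]; exact hL j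
  · simp only [thresholdNetwork, thresholdUnit, dotProduct, map_sum, map_mul, map_sub, map_neg, hev,
      hLx, MvPolynomial.eval_C]

/-! ### Incoherence and subgaussian noise -/

/-- A Chernoff bound for the linear forms of a subgaussian vector. Any positive `v ≥ σ²` may
serve as variance proxy, which covers `σ = 0`. -/
theorem IsSubgaussianVector.measureReal_le_exp {Ω : Type*} [MeasurableSpace Ω] {P : Measure Ω}
    {n : ℕ} {ξ : Ω → Fin n → ℝ} {σ v V ε : ℝ} (hξ : IsSubgaussianVector ξ σ P) (hv : 0 < v)
    (hσv : σ ^ 2 ≤ v) {a : Fin n → ℝ} (haV : ∑ i, a i ^ 2 ≤ V) (hε : 0 < ε) :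
    P.real {ω | ε ≤ a ⬝ᵥ ξ ω} ≤ Real.exp (-ε ^ 2 / (2 * (v * V))) := by
  have hnn : 0 ≤ ∑ i, a i ^ 2 := Finset.sum_nonneg fun i _ => sq_nonneg _
  rcases hnn.eq_or_lt with h0 | hpos
  · have ha : a = 0 := by
      funext i
      have := (Finset.sum_eq_zero_iff_of_nonneg fun i _ => sq_nonneg (a i)).1 h0.symm i
        (Finset.mem_univ i)
      simpa using this
    have : {ω | ε ≤ a ⬝ᵥ ξ ω} = ∅ := by
      ext ω
      simp [ha, hε]
    rw [this, measureReal_empty]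
    positivity
  · set r := Real.sqrt (∑ i, a i ^ 2) with hr
    have hr0 : 0 < r := Real.sqrt_pos.2 hpos
    have hr2 : r ^ 2 = ∑ i, a i ^ 2 := Real.sq_sqrt hnn
    have hu := hξ (r⁻¹ • a) (by
      simp only [Pi.smul_apply, smul_eq_mul, mul_pow]
      rw [← Finset.mul_sum, ← hr2]
      field_simp)
    have hu' : HasSubgaussianMGF (fun ω => (r⁻¹ • a) ⬝ᵥ ξ ω) (Real.toNNReal v) P :=
      ⟨hu.integrable_exp_mul, fun t => (hu.mgf_le t).trans (by gcongr)⟩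
    have h := hu'.measure_ge_le (ε := ε / r) (by positivity)
    have hset : {ω | ε / r ≤ (r⁻¹ • a) ⬝ᵥ ξ ω} = {ω | ε ≤ a ⬝ᵥ ξ ω} := by
      ext ω
      simp only [Set.mem_ofPred_eq, smul_dotProduct, smul_eq_mul]
      rw [div_le_iff₀ hr0]
      field_simp
    rw [hset, Real.coe_toNNReal v hv.le] at h
    refine h.trans (Real.exp_le_exp.2 ?_)
    have e : -(ε / r) ^ 2 / (2 * v) = -(ε ^ 2 / (2 * (v * r ^ 2))) := by field_simp
    rw [e, neg_div, neg_le_neg_iff, hr2]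
    gcongr

/-- The columns of an incoherent matrix have squared Euclidean norm at most `1 + μ`. -/
theorem IsIncoherent.sum_sq_le {n m : ℕ} {A : Matrix (Fin n) (Fin m) ℝ} {μ : ℝ}
    (hA : IsIncoherent A μ) (j : Fin m) : ∑ i, (Aᵀ j i) ^ 2 ≤ 1 + μ := by
  have h := (abs_le.1 (hA j j)).2
  rw [Matrix.sub_apply, Matrix.one_apply_eq, Matrix.mul_apply] at h
  have : ∑ i, (Aᵀ j i) ^ 2 = ∑ i, Aᵀ j i * A i j := by simp [sq]
  linarith

/-- `‖(Aᵀ A - 1) z‖_∞ ≤ μ ‖z‖₁`. -/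
theorem IsIncoherent.abs_mulVec_sub_le {n m : ℕ} {A : Matrix (Fin n) (Fin m) ℝ} {μ M : ℝ}
    (hμ : 0 ≤ μ) (hA : IsIncoherent A μ) {z : Fin m → ℝ} (hz : ∑ j, |z j| ≤ M) (j : Fin m) :
    |(Aᵀ *ᵥ (A *ᵥ z)) j - z j| ≤ μ * M := by
  have e : (Aᵀ *ᵥ (A *ᵥ z)) j - z j = ((Aᵀ * A - 1) *ᵥ z) j := by
    rw [Matrix.sub_mulVec, Matrix.one_mulVec, Matrix.mulVec_mulVec, Pi.sub_apply]
  rw [e, Matrix.mulVec, dotProduct]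
  calc |∑ i, (Aᵀ * A - 1 : Matrix (Fin m) (Fin m) ℝ) j i * z i| ≤
        ∑ i, |(Aᵀ * A - 1 : Matrix (Fin m) (Fin m) ℝ) j i * z i| :=
        Finset.abs_sum_le_sum_abs _ _
    _ ≤ ∑ i, μ * |z i| := by
      refine Finset.sum_le_sum fun i _ => ?_
      rw [abs_mul]
      exact mul_le_mul_of_nonneg_right (hA j i) (abs_nonneg _)
    _ ≤ μ * M := by rw [← Finset.mul_sum]; gcongr

/-- A union bound over the `2 m` linear forms `± ⟨A_j, ξ⟩`. -/
theorem IsSubgaussianVector.measureReal_exists_le {Ω : Type*} [MeasurableSpace Ω] {P : Measure Ω}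
    [IsProbabilityMeasure P] {n m : ℕ} {A : Matrix (Fin n) (Fin m) ℝ} {μ σ τ q : ℝ}
    {ξ : Ω → Fin n → ℝ} (hξ : IsSubgaussianVector ξ σ P) (hA : IsIncoherent A μ) (hm : 2 ≤ m)
    (hμ : 0 ≤ μ) (hσ : 0 ≤ σ) (hq : 0 < q) (hτ : 0 < τ)
    (h : (q + 8) * (σ * Real.sqrt ((1 + μ) * Real.log m)) ≤ τ) :
    P.real {ω | ∃ j, τ / 2 ≤ |(Aᵀ *ᵥ ξ ω) j|} ≤ (m : ℝ) ^ (-q) := by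
  have hm' : (2 : ℝ) ≤ m := by exact_mod_cast hm
  have hlog : 0 < Real.log m := Real.log_pos (by linarith)
  have hm0 : (0 : ℝ) < m := by linarith
  set c := q + 8 with hc
  set v := τ ^ 2 / (c ^ 2 * ((1 + μ) * Real.log m)) with hv
  have hv0 : 0 < v := by positivity
  have hσv : σ ^ 2 ≤ v := by
    rw [hv, le_div_iff₀ (by positivity)]
    have h1 := pow_le_pow_left₀ (by positivity) h 2
    rw [mul_pow, mul_pow, Real.sq_sqrt (by positivity)] at h1
    linarith
  -- The exponent is `-(q + 8)² log m / 8 ≤ -(q + 2) log m`.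
  have hexp : Real.exp (-(τ / 2) ^ 2 / (2 * (v * (1 + μ)))) ≤ (m : ℝ) ^ (-q) / (2 * m) := by
    have e : -(τ / 2) ^ 2 / (2 * (v * (1 + μ))) = -(c ^ 2 / 8 * Real.log m) := by
      rw [hv]; field_simp; ring
    have h2 : (m : ℝ) ^ (-q) / m ^ 2 ≤ (m : ℝ) ^ (-q) / (2 * m) := by
      gcongr; nlinarith
    refine le_trans ?_ h2
    rw [e, ← Real.rpow_natCast (m : ℝ) 2, ← Real.rpow_sub hm0,
      Real.rpow_def_of_pos hm0, Real.exp_le_exp]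
    push_cast
    have : q + 2 ≤ c ^ 2 / 8 := by rw [hc]; nlinarith
    nlinarith
  -- Each of the two signs receives half of the budget `m ^ (-q) / m` of a coordinate.
  have hj : ∀ j, P.real {ω | τ / 2 ≤ |(Aᵀ *ᵥ ξ ω) j|} ≤ (m : ℝ) ^ (-q) / m := by
    intro j
    have hsub : {ω | τ / 2 ≤ |(Aᵀ *ᵥ ξ ω) j|} ⊆
        {ω | τ / 2 ≤ Aᵀ j ⬝ᵥ ξ ω} ∪ {ω | τ / 2 ≤ (-Aᵀ j) ⬝ᵥ ξ ω} := by
      intro ω hω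
      rw [Set.mem_ofPred_eq, le_abs] at hω
      rwa [Set.mem_union, Set.mem_ofPred_eq, Set.mem_ofPred_eq, neg_dotProduct]
    refine (measureReal_mono hsub).trans ((measureReal_union_le _ _).trans ?_)
    have h1 := hξ.measureReal_le_exp hv0 hσv (hA.sum_sq_le j) (half_pos hτ)
    have h2 := hξ.measureReal_le_exp (a := -Aᵀ j) hv0 hσv (by simpa using hA.sum_sq_le j)
      (half_pos hτ)
    have e : (m : ℝ) ^ (-q) / (2 * m) + (m : ℝ) ^ (-q) / (2 * m) = (m : ℝ) ^ (-q) / m := by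
      field_simp; norm_num
    linarith
  rw [Set.ofPred_exists]
  refine (measureReal_iUnion_fintype_le _).trans ((Finset.sum_le_sum fun j _ => hj j).trans ?_)
  rw [Finset.sum_const, Finset.card_univ, Fintype.card_fin, nsmul_eq_mul]
  exact (mul_div_cancel₀ _ hm0.ne').le

/-! ### Recovery -/

theorem mainTheorem3 :
    ∃ D : ℝ, 0 < D ∧ ∀ q : ℝ, 0 < q → ∃ c : ℝ, 0 < c ∧ ∀ C : ℝ, c ≤ C → ∃ K : ℝ, 0 < K ∧
      ∀ (Ω : Type*) [MeasurableSpace Ω] (P : Measure Ω) [IsProbabilityMeasure P]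
        (n m k d : ℕ) (A : Matrix (Fin n) (Fin m) ℝ) (w : Fin m → ℝ) (μ σ M τ η : ℝ)
        (Z : Ω → Fin m → ℝ) (ξ X : Ω → Fin n → ℝ) (Y : Ω → ℝ),
        1 ≤ k → 0 ≤ μ → 0 ≤ σ → 0 ≤ M →
        IsIncoherent A μ →
        ‖w‖ = 1 →
        AEMeasurable Z P →
        IsSubgaussianVector ξ σ P →
        (∀ ω, X ω = A *ᵥ Z ω + ξ ω) →
        (∀ ω, Y ω = w ⬝ᵥ Z ω) →
        P.real {ω | ¬ ((Function.support (Z ω)).ncard ≤ k ∧ ∑ j, |Z ω j| ≤ M)} ≤ η →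
        0 < τ →
        c * (σ * Real.sqrt ((1 + μ) * Real.log m) + μ * M) ≤ τ →
        τ ≤ C * (σ * Real.sqrt ((1 + μ) * Real.log m) + μ * M) →
        DegreeAtLeast D m τ M d →
        (∃ F : MvPolynomial (Fin n) ℝ, F.totalDegree ≤ d ∧
          ∀ x, MvPolynomial.eval x F = polyEstimator d τ M A w x) ∧
        P.real {ω | K * ((k : ℝ) ^ 2 * ((1 + μ) * σ ^ 2 * Real.log m + μ ^ 2 * M ^ 2)) <
            (polyEstimator d τ M A w (X ω) - Y ω) ^ 2} ≤ η + (m : ℝ) ^ (-q) := by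
  -- `q + 8` makes each tail probability at most `m ^ (-q - 2)`, and the constant
  -- `320000 = 2 * 400²` comes from squaring the error `400 k τ`.
  refine ⟨576, by norm_num, fun q hq => ⟨q + 8, by linarith, fun C hC =>
    ⟨320000 * C ^ 2, by have : 0 < C := by linarith
                        positivity, ?_⟩⟩⟩
  intro Ω _ P _ n m k d A w μ σ M τ η Z ξ X Y hk hμ hσ hM hA hw _ hξ hX hY hη hτ hτ1 hτ2 hd
  refine ⟨?_, ?_⟩
  · obtain ⟨F, hF, hFx⟩ := exists_mvPolynomial_eq_thresholdNetwork
      (reluPoly d (τ / (M + 2 * τ)) (M + 2 * τ)) τ A w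
    exact ⟨F, hF.trans (natDegree_reluPoly_le _ _ _), hFx⟩
  have hη0 : 0 ≤ η := measureReal_nonneg.trans hη
  have hmne : m ≠ 0 := by
    rintro rfl
    rw [Subsingleton.elim w 0, norm_zero] at hw
    exact zero_ne_one hw
  -- For `m = 1` the claimed probability bound is at least `1`.
  obtain rfl | hm : m = 1 ∨ 2 ≤ m := by omega
  · rw [Nat.cast_one, Real.one_rpow]
    exact measureReal_le_one.trans (by linarith)
  have hlog : 0 ≤ Real.log m := Real.log_natCast_nonneg m
  have hμM : 0 ≤ μ * M := mul_nonneg hμ hM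
  set a := σ * Real.sqrt ((1 + μ) * Real.log m) with ha
  have ha0 : 0 ≤ a := by positivity
  have ha2 : a ^ 2 = (1 + μ) * σ ^ 2 * Real.log m := by
    rw [ha, mul_pow, Real.sq_sqrt (by positivity)]; ring
  have hnoise := hξ.measureReal_exists_le hA hm hμ hσ hq hτ
    ((mul_le_mul_of_nonneg_left (le_add_of_nonneg_right hμM) (by linarith)).trans hτ1)
  refine le_trans (measureReal_mono ?_) ((measureReal_union_le _ _).trans (add_le_add hη hnoise))
  intro ω hω
  by_contra hgood
  rw [Set.mem_union, not_or, Set.mem_ofPred_eq, Set.mem_ofPred_eq, not_not, not_exists] at hgood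
  obtain ⟨⟨hsupp, hl1⟩, hsmall⟩ := hgood
  have hμτ : μ * M ≤ τ / 2 := by
    nlinarith [mul_nonneg hq.le (add_nonneg ha0 hμM)]
  have hdist : ∀ j, |(Aᵀ *ᵥ X ω) j - Z ω j| ≤ τ := by
    intro j
    have e : (Aᵀ *ᵥ X ω) j - Z ω j =
        ((Aᵀ *ᵥ (A *ᵥ Z ω)) j - Z ω j) + (Aᵀ *ᵥ ξ ω) j := by
      rw [hX, Matrix.mulVec_add, Pi.add_apply]; ring
    rw [e]
    refine (abs_add_le _ _).trans ?_
    linarith [hA.abs_mulVec_sub_le hμ hl1 j, not_le.1 (hsmall j)]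
  have herr := abs_dotProduct_thresholdUnit_sub_le hk hm hτ hM (hd.log_le_sqrt hm hτ hM) hw.le
    hdist hl1 hsupp
  rw [Set.mem_ofPred_eq] at hω
  refine absurd hω (not_lt.2 ?_)
  rw [hY]
  have hτ3 : τ ^ 2 ≤ C ^ 2 * (2 * (a ^ 2 + μ ^ 2 * M ^ 2)) := by
    calc τ ^ 2 ≤ (C * (a + μ * M)) ^ 2 := pow_le_pow_left₀ hτ.le hτ2 2
      _ = C ^ 2 * (a + μ * M) ^ 2 := mul_pow _ _ _
      _ ≤ _ := by gcongr; nlinarith [sq_nonneg (a - μ * M)]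
  calc (polyEstimator d τ M A w (X ω) - w ⬝ᵥ Z ω) ^ 2 ≤ (400 * (k * τ)) ^ 2 :=
        sq_le_sq' (abs_le.1 herr).1 (abs_le.1 herr).2
    _ = 160000 * k ^ 2 * τ ^ 2 := by ring
    _ ≤ 160000 * k ^ 2 * (C ^ 2 * (2 * (a ^ 2 + μ ^ 2 * M ^ 2))) := by gcongr
    _ = _ := by rw [ha2]; ring
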